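/- Let $Y$ and $U$ be real Banach spaces that are uniformly convex and uniformly smooth, let $p\in(1,\infty)$, and let $S\colon U\to Y$ be a function that is not affine-linear (i.e., not the sum of a linear map and a constant) and that is weak-to-weak continuous: if $u_n\rightharpoonup u$ weakly in $U$, then $S(u_n)\rightharpoonup S(u)$ weakly in $Y$. For $(y_d,u_d)\in Y\times U$, denote by $P(y_d,u_d)$ the problem $$\min_{(y,u)\in Y\times U}\ \|y-y_d\|_Y^p+\|u-u_d\|_U^p\quad\text{s.t. } y=S(u).$$ Then there exist a tuple $(y_d,u_d)\in Y\times U$, sequences $\{(y_{d,n},u_{d,n})\}_{n\in\mathbb N}$ and $\{(y_{d,n}',u_{d,n}')\}_{n\in\mathbb N}$ in $Y\times U$, and elements $(\bar y,\bar u),(\bar y',\bar u')\in Y\times U$ such that (i) both sequences converge strongly in $Y\times U$ to $(y_d,u_d)$; (ii) for every $n\in\mathbb N$, $(\bar y,\bar u)$ is the unique global solution of $P(y_{d,n},u_{d,n})$; (iii) for every $n\in\mathbb N$, $(\bar y',\bar u')$ is the unique global solution of $P(y_{d,n}',u_{d,n}')$; (iv) $(\bar y,\bar u)\neq(\bar y',\bar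 u')$. Consequently, the solution map has no continuous selection: there is no continuous function $F\colon Y\times U\to Y\times U$ such that $F(y_d,u_d)$ is a global solution of $P(y_d,u_d)$ for all $(y_d,u_d)\in Y\times U$, and there is no continuous function $F\colon Y\times U\to U$ such that $(S(F(y_d,u_d)),F(y_d,u_d))$ is a global solution of $P(y_d,u_d)$ for all $(y_d,u_d)\in Y\times U$. -/

import Mathlib

open Filter Topology

/-- A real normed space `E` is *uniformly smooth* if `‖x + y‖ + ‖x - y‖ ≤ 2 + ε ‖y‖` holds for all
unit vectors `x` and all sufficiently small `y`, uniformly in `x`. In terms of the modulus of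
smoothness `ρ t = sup {(‖x + t • v‖ + ‖x - t • v‖) / 2 - 1 : ‖x‖ = ‖v‖ = 1}`, this says that
`ρ t / t → 0` as `t` tends to `0` from above. -/
class UniformSmoothSpace (E : Type*) [SeminormedAddCommGroup E] : Prop where
  uniform_smooth : ∀ ε : ℝ, 0 < ε → ∃ δ : ℝ, 0 < δ ∧
    ∀ x y : E, ‖x‖ = 1 → ‖y‖ ≤ δ → ‖x + y‖ + ‖x - y‖ ≤ 2 + ε * ‖y‖

/-- Weak convergence of the sequence `x` to `l`: convergence in the weak topology. -/
def WeaklyConverges {E : Type*} [NormedAddCommGroup E] [NormedSpace ℝ E] (x : ℕ → E) (l : E) :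
    Prop :=
  Tendsto (fun n => toWeakSpace ℝ E (x n)) atTop (𝓝 (toWeakSpace ℝ E l))

/-- Weak-to-weak (sequential) continuity of a map between normed spaces. -/
def WeakToWeakContinuous {U Y : Type*} [NormedAddCommGroup U] [NormedSpace ℝ U]
    [NormedAddCommGroup Y] [NormedSpace ℝ Y] (S : U → Y) : Prop :=
  ∀ (u : ℕ → U) (l : U), WeaklyConverges u l → WeaklyConverges (fun n => S (u n)) (S l)

/-- `S` is affine-linear, i.e. a linear map plus a constant. -/
def IsAffineLinear {U Y : Type*} [NormedAddCommGroup U] [NormedSpace ℝ U]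
    [NormedAddCommGroup Y] [NormedSpace ℝ Y] (S : U → Y) : Prop :=
  ∃ (L : U →ₗ[ℝ] Y) (c : Y), ∀ u : U, S u = L u + c

/-- The tracking-type objective `‖y - y_d‖ ^ p + ‖u - u_d‖ ^ p`, for the data `d = (y_d, u_d)` and
the point `z = (y, u)`. -/
noncomputable def trackingObjective {Y U : Type*} [NormedAddCommGroup Y] [NormedAddCommGroup U]
    (p : ℝ) (d z : Y × U) : ℝ :=
  ‖z.1 - d.1‖ ^ p + ‖z.2 - d.2‖ ^ p

/-- The set of global solutions `(y, u)` of the problem `P(y_d, u_d)`, `d = (y_d, u_d)`: minimize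
`‖y - y_d‖ ^ p + ‖u - u_d‖ ^ p` over all `(y, u)` in `Y × U` with `y = S u`. -/
def solutionSet {Y U : Type*} [NormedAddCommGroup Y] [NormedAddCommGroup U]
    (p : ℝ) (S : U → Y) (d : Y × U) : Set (Y × U) :=
  {z | z.1 = S z.2 ∧ ∀ w : Y × U, w.1 = S w.2 → trackingObjective p d z ≤ trackingObjective p d w}

/-!
For `q = ENNReal.ofReal p`, the solutions of the problem with data `d` are the nearest points of `d`
in the graph of `S`, seen as a subset of the `ℓ^q`-sum `WithLp q (Y × U)`. The proof rests on the
fact that this graph cannot be a Chebyshev set, i.e. that some `d` has two distinct nearest points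
`z` and `z'`. The `ℓ^q`-sum is strictly convex, so `z` is the only nearest point of every other
point of the segment from `d` to `z`, and likewise for `z'`. Sequences on the two segments that tend
to `d` thus have the constant unique solutions `z` and `z'`, and no selection of solutions can be
continuous at `d`.

Suppose the graph were a Chebyshev set.

* A minimizing sequence for the distance to a point of the `ℓ^q`-sum has bounded second components,
  so a subsequence of them converges weakly (`exists_weaklyConverges_subseq`). By weak continuity
  of `S`, the first components converge weakly as well, and to the right limit. Lower
  semicontinuity of both norms and the Radon–Riesz property upgrade this to norm convergence
  (`approximativelyCompact_lpGraph`). Nearest points therefore exist, and the metric projection is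
  continuous (`ApproximativelyCompact.continuous_projection`).
* By Vlasov's theorem (`midpoint_mem_of_continuous_projection`), a set with a continuous metric
  projection in a uniformly smooth Banach space is midpoint convex. Indeed the distance to the set
  grows with slope almost one when one moves away from the nearest point; by Ekeland's principle
  this growth continues up to any radius `R`. If the midpoint of two points of the set is not in
  it, then there are arbitrarily large open balls that avoid the set and contain this midpoint at a
  depth bounded below. By smoothness they resemble half-spaces, and two points lying opposite each
  other with respect to the midpoint cannot both be outside.
* A map with a midpoint convex graph preserves midpoints, and by weak continuity it is then
  affine-linear (`isAffineLinear_of_map_midpoint`).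

Weak compactness is obtained without the bidual: in a uniformly convex Banach space, a directed
family of bounded closed convex sets has a common point, since almost minimal elements form a
Cauchy sequence (`exists_mem_of_filter_closedConvex`).
-/

/-! ### Ekeland's principle -/

/-- **Ekeland's variational principle**, in the form of a maximal element. -/
theorem exists_maximal_growth {X : Type*} [MetricSpace X] [CompleteSpace X] {φ : X → ℝ}
    (hφ : Continuous φ) {B : Set X} (hB : IsClosed B) (hbdd : BddAbove (φ '' B)) {σ : ℝ}
    (hσ : 0 < σ) {x₀ : X} (hx₀ : x₀ ∈ B) :
    ∃ y ∈ B, φ x₀ + σ * dist x₀ y ≤ φ y ∧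
      ∀ z ∈ B, φ y + σ * dist y z ≤ φ z → z = y := by
  let T : X → Set X := fun x => {z | z ∈ B ∧ φ x + σ * dist x z ≤ φ z}
  have hTcl : ∀ x, IsClosed (T x) := fun x =>
    hB.inter (isClosed_le (by fun_prop) hφ)
  have hTtrans : ∀ {x y z}, y ∈ T x → z ∈ T y → z ∈ T x := by
    intro x y z hy hz
    refine ⟨hz.1, ?_⟩
    have h1 := hy.2
    have h2 := hz.2
    have h3 := mul_le_mul_of_nonneg_left (dist_triangle x y z) hσ.le
    linarith
  -- Each step gains at least half of the remaining possible increase of `φ`.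
  have step : ∀ x : B, ∃ y : B, (y : X) ∈ T x ∧ ∀ z ∈ T x, φ z ≤ 2 * φ y - φ x := by
    intro x
    have hxT : (x : X) ∈ T x := ⟨x.2, by simp⟩
    have hb : BddAbove (φ '' T x) := hbdd.mono (Set.image_mono fun z hz => hz.1)
    have hle : φ x ≤ sSup (φ '' T x) := le_csSup hb ⟨x, hxT, rfl⟩
    rcases hle.eq_or_lt with h | h
    · refine ⟨x, hxT, fun z hz => ?_⟩
      have := le_csSup hb ⟨z, hz, rfl⟩
      linarith
    · obtain ⟨_, ⟨y, hy, rfl⟩, hlt⟩ :=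
        exists_lt_of_lt_csSup (⟨_, x, hxT, rfl⟩ : (φ '' T x).Nonempty)
          (show (φ x + sSup (φ '' T x)) / 2 < sSup (φ '' T x) by linarith)
      refine ⟨⟨y, hy.1⟩, hy, fun z hz => ?_⟩
      have := le_csSup hb ⟨z, hz, rfl⟩
      simp only
      linarith
  choose g hgT hgmax using step
  let x : ℕ → B := fun n => g^[n] ⟨x₀, hx₀⟩
  have hxs : ∀ n, x (n + 1) = g (x n) := fun n => Function.iterate_succ_apply' g n _
  have hstep : ∀ n, (x (n + 1) : X) ∈ T (x n) := fun n => by rw [hxs]; exact hgT _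
  have hmem : ∀ n m, n ≤ m → (x m : X) ∈ T (x n) := by
    intro n m hnm
    induction m, hnm using Nat.le_induction with
    | base => exact ⟨(x n).2, by simp⟩
    | succ m _ ih => exact hTtrans ih (hstep m)
  have hmono : Monotone fun n => φ (x n) := monotone_nat_of_le_succ fun n => by
    have := (hstep n).2
    have := mul_nonneg hσ.le (dist_nonneg (x := (x n : X)) (y := x (n + 1)))
    linarith
  have hlim : Tendsto (fun n => φ (x n)) atTop (𝓝 (⨆ n, φ (x n))) :=
    tendsto_atTop_ciSup hmono (hbdd.mono (by rintro _ ⟨n, rfl⟩; exact ⟨_, (x n).2, rfl⟩))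
  have hcau : CauchySeq fun n => (x n : X) := by
    rw [Metric.cauchySeq_iff']
    intro ε hε
    obtain ⟨N, hN⟩ := Metric.cauchySeq_iff'.1 hlim.cauchySeq (σ * ε) (by positivity)
    refine ⟨N, fun n hn => ?_⟩
    have h1 := (hmem N n hn).2
    have h2 := (abs_lt.1 (hN n hn)).2
    rw [dist_comm]
    exact lt_of_mul_lt_mul_left (by linarith) hσ.le
  obtain ⟨y, hy⟩ := cauchySeq_tendsto_of_complete hcau
  have hyT : ∀ n, y ∈ T (x n) := fun n =>
    (hTcl _).mem_of_tendsto hy (eventually_atTop.2 ⟨n, hmem n⟩)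
  refine ⟨y, (hyT 0).1, (hyT 0).2, fun z hzB hz => ?_⟩
  have h1 : ∀ n, φ z ≤ 2 * φ (x (n + 1)) - φ (x n) := fun n => by
    rw [hxs]; exact hgmax _ z (hTtrans (hyT n) ⟨hzB, hz⟩)
  have hφy : Tendsto (fun n => φ (x n)) atTop (𝓝 (φ y)) := (hφ.tendsto y).comp hy
  have h2 : φ z ≤ 2 * φ y - φ y :=
    ge_of_tendsto' (((hφy.comp (tendsto_add_atTop_nat 1)).const_mul 2).sub hφy) h1
  have h3 : dist y z ≤ 0 := by
    by_contra! h
    have := mul_pos hσ h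
    linarith
  exact (dist_le_zero.1 h3).symm

/-! ### Chebyshev sets with continuous metric projection -/

section Chebyshev

variable {X : Type*} [NormedAddCommGroup X] [NormedSpace ℝ X] {M : Set X} {P : X → X}

/-- Moving away from the nearest point increases the distance to `M` at almost unit rate. -/
theorem exists_near_infDist_growth (hPM : ∀ x, P x ∈ M)
    (hPd : ∀ x, ‖x - P x‖ = Metric.infDist x M) (hPc : Continuous P) {x : X} (hx : x ∉ M)
    {σ : ℝ} (hσ : σ < 1) {V : Set X} (hV : V ∈ 𝓝 x) :
    ∃ y ∈ V, y ≠ x ∧ Metric.infDist x M + σ * dist x y ≤ Metric.infDist y M := by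
  set D := Metric.infDist x M with hD
  have hxP : x - P x ≠ 0 := fun h => hx (by rw [sub_eq_zero.1 h]; exact hPM x)
  have hDpos : 0 < D := by rw [hD, ← hPd]; exact norm_pos_iff.2 hxP
  have hcont : Tendsto (fun t : ℝ => x + t • (x - P x)) (𝓝[>] 0) (𝓝 x) := by
    have : ContinuousAt (fun t : ℝ => x + t • (x - P x)) 0 := by fun_prop
    have h := this.tendsto
    simp only [zero_smul, add_zero] at h
    exact h.mono_left nhdsWithin_le_nhds
  have hnear : ∀ᶠ t : ℝ in 𝓝[>] 0, ‖P (x + t • (x - P x)) - P x‖ < (1 - σ) * D := by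
    have := ((hPc.tendsto x).comp hcont).eventually
      (Metric.ball_mem_nhds (P x) (mul_pos (sub_pos.2 hσ) hDpos))
    simpa [dist_eq_norm] using this
  obtain ⟨t, ⟨ht1, ht2⟩, ht⟩ :=
    ((hnear.and (hcont.eventually hV)).and self_mem_nhdsWithin).exists
  have ht : 0 < t := ht
  set y := x + t • (x - P x) with hy
  refine ⟨y, ht2, by simpa [hy, ht.ne'] using hxP, ?_⟩
  have hdist : dist x y = t * D := by
    rw [dist_comm, dist_eq_norm, hy, add_sub_cancel_left, norm_smul, hPd, Real.norm_eq_abs,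
      abs_of_pos ht]
  -- Compare along a functional that supports the ball around the origin at `x - P y`.
  obtain ⟨f, hf1, hf2⟩ := exists_dual_vector'' ℝ (x - P y)
  have hfle : ∀ v, f v ≤ ‖v‖ := fun v => (le_abs_self _).trans
    ((f.le_opNorm v).trans (by nlinarith [norm_nonneg v]))
  have h1 : D ≤ f (x - P y) := by
    rw [hf2]
    have := Metric.infDist_le_dist_of_mem (x := x) (hPM y)
    rw [dist_eq_norm] at this
    simpa using this
  have h2 : f (x - P y) + t * f (x - P x) ≤ ‖y - P y‖ := by
    have := hfle (y - P y)
    have e : y - P y = (x - P y) + t • (x - P x) := by rw [hy]; abel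
    rw [e, map_add, map_smul, smul_eq_mul, ← e] at this
    exact this
  have h3 : f (x - P y) ≤ f (x - P x) + ‖P y - P x‖ := by
    have := hfle (P x - P y)
    have e : x - P y = (x - P x) + (P x - P y) := by abel
    rw [e, map_add, norm_sub_rev]
    linarith
  have h4 : σ * D ≤ f (x - P x) := by linarith
  have h5 := mul_le_mul_of_nonneg_left h4 ht.le
  rw [hdist, ← hPd y]
  linarith

/-- The almost unit growth of the distance to `M` persists up to any prescribed radius. -/
theorem exists_infDist_growth [CompleteSpace X] (hPM : ∀ x, P x ∈ M)
    (hPd : ∀ x, ‖x - P x‖ = Metric.infDist x M) (hPc : Continuous P) {x : X} (hx : x ∉ M)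
    {σ : ℝ} (hσ0 : 0 < σ) (hσ : σ < 1) {R : ℝ} (hR : 0 ≤ R) :
    ∃ y, dist x y = R ∧ Metric.infDist x M + σ * R ≤ Metric.infDist y M := by
  have hpos : ∀ z, z ∉ M → 0 < Metric.infDist z M := fun z hz => by
    rw [← hPd]
    exact norm_pos_iff.2 fun h => hz (by rw [sub_eq_zero.1 h]; exact hPM z)
  obtain ⟨y, hyB, hy, hmax⟩ := exists_maximal_growth (φ := fun z => Metric.infDist z M)
    (Metric.continuous_infDist_pt M) (B := Metric.closedBall x R) Metric.isClosed_closedBall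
    ⟨Metric.infDist x M + R, by
      rintro _ ⟨z, hz, rfl⟩
      exact Metric.infDist_le_infDist_add_dist.trans (by gcongr; exact hz)⟩
    hσ0 (Metric.mem_closedBall_self hR)
  have hyM : y ∉ M := fun h => by
    have h1 := hpos x hx
    have h2 := mul_nonneg hσ0.le (dist_nonneg (x := x) (y := y))
    rw [Metric.infDist_zero_of_mem h] at hy
    linarith
  have hyR : dist x y = R := by
    rw [Metric.mem_closedBall, dist_comm] at hyB
    refine hyB.eq_of_not_lt fun hlt => ?_
    obtain ⟨z, hz1, hz2, hz3⟩ := exists_near_infDist_growth hPM hPd hPc hyM hσ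
      (Metric.isOpen_ball.mem_nhds (show y ∈ Metric.ball x R by
        rwa [Metric.mem_ball, dist_comm]))
    exact hz2 (hmax z (Metric.ball_subset_closedBall hz1) hz3)
  exact ⟨y, hyR, by rwa [hyR] at hy⟩

/-- **Vlasov's theorem**: in a uniformly smooth Banach space, a set with a continuous metric
projection is midpoint convex. -/
theorem midpoint_mem_of_continuous_projection [CompleteSpace X] [UniformSmoothSpace X]
    (hPM : ∀ x, P x ∈ M) (hPd : ∀ x, ‖x - P x‖ = Metric.infDist x M) (hPc : Continuous P)
    {a b : X} (ha : a ∈ M) (hb : b ∈ M) : midpoint ℝ a b ∈ M := by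
  by_contra hx
  set x := midpoint ℝ a b with hxdef
  set D := Metric.infDist x M with hD
  have hDpos : 0 < D := by
    rw [hD, ← hPd]
    exact norm_pos_iff.2 fun h => hx (by rw [sub_eq_zero.1 h]; exact hPM x)
  set w := a - x with hw
  have hbw : b - x = -w := by
    rw [hw, hxdef, midpoint_eq_smul_add, invOf_eq_inv]
    module
  have hw0 : 0 < ‖w‖ := norm_pos_iff.2 fun h => hx (by rw [← sub_eq_zero.1 h]; exact ha)
  obtain ⟨δ, hδ, hsm⟩ := UniformSmoothSpace.uniform_smooth (E := X) (D / ‖w‖) (by positivity)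
  set R := ‖w‖ / δ with hRdef
  have hR : 0 < R := by positivity
  -- With `2 * (1 - σ) * R < D`, the growth beats what uniform smoothness allows.
  set σ := 1 - min (1 / 2) (D / (4 * R)) with hσ
  have hm0 : 0 < min (1 / 2 : ℝ) (D / (4 * R)) := lt_min (by norm_num) (by positivity)
  have hm1 := min_le_left (1 / 2 : ℝ) (D / (4 * R))
  have hm2 : (1 - σ) * (4 * R) ≤ D := by
    rw [hσ, sub_sub_cancel, ← le_div_iff₀ (by positivity)]
    exact min_le_right _ _
  obtain ⟨y, hyR, hy⟩ := exists_infDist_growth hPM hPd hPc hx (σ := σ) (by linarith)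
    (by linarith) hR.le
  set v := R⁻¹ • (y - x) with hv
  have hv1 : ‖v‖ = 1 := by
    rw [hv, norm_smul, ← dist_eq_norm, dist_comm, hyR, norm_inv, Real.norm_eq_abs, abs_of_pos hR,
      inv_mul_cancel₀ hR.ne']
  have key : ∀ c ∈ M, D + σ * R ≤ R * ‖v - R⁻¹ • (c - x)‖ := by
    intro c hc
    have h := hy.trans (Metric.infDist_le_dist_of_mem hc)
    have e : v - R⁻¹ • (c - x) = R⁻¹ • (y - c) := by rw [hv]; module
    rw [e, norm_smul, norm_inv, Real.norm_eq_abs, abs_of_pos hR, mul_inv_cancel_left₀ hR.ne',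
      ← dist_eq_norm]
    exact h
  have h1 := key a ha
  have h2 := key b hb
  rw [← hw] at h1
  rw [hbw, smul_neg, sub_neg_eq_add] at h2
  have hwn : ‖R⁻¹ • w‖ = R⁻¹ * ‖w‖ := by
    rw [norm_smul, norm_inv, Real.norm_eq_abs, abs_of_pos hR]
  have h3 := hsm v (R⁻¹ • w) hv1 (by rw [hwn, hRdef]; field_simp; rfl)
  rw [hwn] at h3
  have h4 := mul_le_mul_of_nonneg_left h3 hR.le
  have h5 : R * (2 + D / ‖w‖ * (R⁻¹ * ‖w‖)) = 2 * R + D := by field_simp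
  rw [h5] at h4
  nlinarith

end Chebyshev

/-! ### Weak convergence in uniformly convex spaces -/

section WeakConvergence

variable {E : Type*} [NormedAddCommGroup E] [NormedSpace ℝ E]

theorem weaklyConverges_iff {x : ℕ → E} {l : E} :
    WeaklyConverges x l ↔ ∀ f : E →L[ℝ] ℝ, Tendsto (fun n => f (x n)) atTop (𝓝 (f l)) :=
  WeakBilin.tendsto_iff_forall_eval_tendsto (topDualPairing ℝ E).flip fun _ _ h =>
    (SeparatingDual.eq_iff_forall_dual_eq (R := ℝ)).2 fun f => DFunLike.congr_fun h f

theorem WeaklyConverges.add_const {x : ℕ → E} {l : E} (h : WeaklyConverges x l) (c : E) :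
    WeaklyConverges (fun n => x n + c) (l + c) := by
  rw [weaklyConverges_iff] at h ⊢
  intro f
  simpa using (h f).add_const (f c)

theorem Filter.Tendsto.weaklyConverges {x : ℕ → E} {l : E} (h : Tendsto x atTop (𝓝 l)) :
    WeaklyConverges x l :=
  weaklyConverges_iff.2 fun f => (f.continuous.tendsto l).comp h

/-- Weak sequential lower semicontinuity of the norm. -/
theorem WeaklyConverges.eventually_lt_norm {x : ℕ → E} {l : E} (h : WeaklyConverges x l) {r : ℝ}
    (hr : r < ‖l‖) : ∀ᶠ n in atTop, r < ‖x n‖ := by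
  obtain ⟨f, hf1, hf2⟩ := exists_dual_vector'' ℝ l
  have hfl : r < f l := by rw [hf2]; exact hr
  filter_upwards [(weaklyConverges_iff.1 h f).eventually (lt_mem_nhds hfl)] with n hn
  exact hn.trans_le ((le_abs_self _).trans
    ((f.le_opNorm _).trans (by nlinarith [norm_nonneg (x n)])))

/-- **Radon–Riesz property** of uniformly convex spaces. -/
theorem WeaklyConverges.tendsto_of_norm [UniformConvexSpace E] {x : ℕ → E} {l : E}
    (h : WeaklyConverges x l) (hn : Tendsto (fun n => ‖x n‖) atTop (𝓝 ‖l‖)) :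
    Tendsto x atTop (𝓝 l) := by
  rcases eq_or_ne l 0 with rfl | hl
  · rw [norm_zero] at hn
    exact tendsto_zero_iff_norm_tendsto_zero.2 hn
  have hl0 : 0 < ‖l‖ := norm_pos_iff.2 hl
  -- Rescale to the sphere through `l`.
  set y : ℕ → E := fun n => (‖l‖ / ‖x n‖) • x n with hy
  have hc : Tendsto (fun n => ‖l‖ / ‖x n‖) atTop (𝓝 1) := by
    have := (tendsto_const_nhds (x := ‖l‖)).div hn hl0.ne'
    rwa [div_self hl0.ne'] at this
  have hyn : ∀ n, ‖y n‖ ≤ ‖l‖ := by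
    intro n
    rw [hy, norm_smul, Real.norm_eq_abs, abs_of_nonneg (by positivity)]
    rcases eq_or_ne ‖x n‖ 0 with h0 | h0
    · simp [h0]
    · rw [div_mul_cancel₀ _ h0]
  have hyw : WeaklyConverges y l := weaklyConverges_iff.2 fun f => by
    simpa [hy] using hc.mul (weaklyConverges_iff.1 h f)
  have hylim : Tendsto y atTop (𝓝 l) := by
    rw [Metric.tendsto_atTop']
    intro ε hε
    obtain ⟨δ, hδ, H⟩ := exists_forall_closed_ball_dist_add_le_two_mul_sub E hε ‖l‖
    have h2 : 2 * ‖l‖ - δ < ‖l + l‖ := by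
      rw [← two_smul ℝ l, norm_smul, Real.norm_two]
      linarith
    obtain ⟨N, hN⟩ := eventually_atTop.1 ((hyw.add_const l).eventually_lt_norm h2)
    refine ⟨N, fun n hn => ?_⟩
    rw [dist_eq_norm]
    by_contra! hge
    exact (H (hyn n) le_rfl hge).not_gt (hN n hn.le)
  have hc' : Tendsto (fun n => ‖x n‖ / ‖l‖) atTop (𝓝 1) := by
    have := hn.div_const ‖l‖
    rwa [div_self hl0.ne'] at this
  have := hc'.smul hylim
  rw [one_smul] at this
  refine this.congr' ?_
  filter_upwards [hn.eventually (lt_mem_nhds hl0)] with n hn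
  rw [hy, smul_smul, div_mul_div_cancel₀ hl0.ne', div_self hn.ne', one_smul]

/-- The closed convex hulls of the images of the sets of a filter, under a bounded family, have a
common point in a uniformly convex Banach space. This is the form of reflexivity that is used
below. -/
theorem exists_mem_of_filter_closedConvex [CompleteSpace E] [UniformConvexSpace E]
    {ι : Type*} {F : Filter ι} [F.NeBot] (x : ι → E) {C : ℝ} (hx : ∀ i, ‖x i‖ ≤ C) :
    ∃ l : E, ∀ A ∈ F, l ∈ closure (convexHull ℝ (x '' A)) := by
  let K : Set ι → Set E := fun A => closure (convexHull ℝ (x '' A))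
  have hKmono : ∀ {A B}, A ⊆ B → K A ⊆ K B := fun h =>
    closure_mono (convexHull_mono (Set.image_mono h))
  have hKne : ∀ {A}, A ∈ F → (K A).Nonempty := fun hA =>
    (((F.nonempty_of_mem hA).image x).convexHull).closure
  have hKconv : ∀ A, Convex ℝ (K A) := fun A => (convex_convexHull ℝ _).closure
  let d : Set ι → ℝ := fun A => Metric.infDist 0 (K A)
  have hdle : ∀ {A} {y}, y ∈ K A → d A ≤ ‖y‖ := fun hy => by
    simpa using Metric.infDist_le_dist_of_mem (x := (0 : E)) hy
  have hdC : ∀ {A}, A ∈ F → d A ≤ C := by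
    intro A hA
    obtain ⟨i, hi⟩ := F.nonempty_of_mem hA
    exact (hdle (subset_closure (subset_convexHull ℝ _ ⟨i, hi, rfl⟩))).trans (hx i)
  -- `D` is the limit, along the directed family `K A`, of the distances from the origin.
  let s : Set ℝ := d '' {A | A ∈ F}
  have hsb : BddAbove s := ⟨C, by rintro _ ⟨A, hA, rfl⟩; exact hdC hA⟩
  have hsne : s.Nonempty := ⟨_, Set.univ, univ_mem, rfl⟩
  set D := sSup s with hD
  have hdD : ∀ {A}, A ∈ F → d A ≤ D := fun hA => le_csSup hsb ⟨_, hA, rfl⟩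
  have hD0 : 0 ≤ D := Metric.infDist_nonneg.trans (hdD univ_mem)
  have hclose : ∀ η : ℝ, 0 < η → ∃ A ∈ F, ∃ ε : ℝ, 0 < ε ∧
      ∀ y ∈ K A, ∀ z ∈ K A, ‖y‖ ≤ D + ε → ‖z‖ ≤ D + ε → ‖y - z‖ ≤ η := by
    intro η hη
    rcases hD0.eq_or_lt with h0 | hDpos
    · refine ⟨Set.univ, univ_mem, η / 2, by positivity, fun y _ z _ hy hz => ?_⟩
      have := norm_sub_le y z
      linarith
    obtain ⟨δ, hδ, H⟩ := exists_forall_closed_ball_dist_add_le_two_mul_sub E (half_pos hη) D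
    set ε := min (η / 4) (δ / 8) with hε
    have hε0 : 0 < ε := lt_min (by positivity) (by positivity)
    have hε1 : ε ≤ η / 4 := min_le_left _ _
    have hε2 : ε ≤ δ / 8 := min_le_right _ _
    obtain ⟨_, ⟨A, hA, rfl⟩, hAD⟩ := exists_lt_of_lt_csSup hsne (show D - ε < D by linarith)
    refine ⟨A, hA, ε, hε0, fun y hyK z hzK hy hz => ?_⟩
    have hscale : ∀ v : E, ‖v‖ ≤ D + ε →
        ‖(D / (D + ε)) • v‖ ≤ D ∧ ‖v - (D / (D + ε)) • v‖ ≤ ε := by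
      intro v hv
      have hpos : 0 < D + ε := by positivity
      constructor
      · rw [norm_smul, Real.norm_eq_abs, abs_of_nonneg (by positivity), div_mul_eq_mul_div,
          div_le_iff₀ hpos]
        gcongr
      · have e : v - (D / (D + ε)) • v = (ε / (D + ε)) • v := by
          have : ε / (D + ε) = 1 - D / (D + ε) := by field_simp; ring
          rw [this, sub_smul, one_smul]
        rw [e, norm_smul, Real.norm_eq_abs, abs_of_nonneg (by positivity), div_mul_eq_mul_div,
          div_le_iff₀ hpos]
        gcongr
    obtain ⟨hy1, hy2⟩ := hscale y hy
    obtain ⟨hz1, hz2⟩ := hscale z hz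
    set y' := (D / (D + ε)) • y
    set z' := (D / (D + ε)) • z
    have hmid : d A ≤ ‖(2⁻¹ : ℝ) • y + (2⁻¹ : ℝ) • z‖ :=
      hdle (hKconv A hyK hzK (by norm_num) (by norm_num) (by norm_num))
    rw [← smul_add, norm_smul, norm_inv, Real.norm_two] at hmid
    have hsum : ‖y + z‖ ≤ ‖y' + z'‖ + ‖y - y'‖ + ‖z - z'‖ := by
      have e : y + z = (y' + z') + (y - y') + (z - z') := by abel
      rw [e]; exact norm_add₃_le
    have hdiff : ‖y - z‖ ≤ ‖y' - z'‖ + ‖y - y'‖ + ‖z - z'‖ := by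
      have e : y - z = (y' - z') + (y - y') - (z - z') := by abel
      rw [e]
      exact (norm_sub_le _ _).trans (by gcongr; exact norm_add_le _ _)
    have hlt : ‖y' - z'‖ < η / 2 := by
      by_contra! hge
      have := H hy1 hz1 hge
      linarith
    linarith
  have hex : ∀ A ∈ F, ∀ ε : ℝ, 0 < ε → ∃ y ∈ K A, ‖y‖ ≤ D + ε := by
    intro A hA ε hε
    obtain ⟨y, hy, hlt⟩ := (Metric.infDist_lt_iff (hKne hA)).1
      (show Metric.infDist 0 (K A) < D + ε by have := hdD hA; simp only [d] at this; linarith)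
    exact ⟨y, hy, by simpa using hlt.le⟩
  -- Elements of ever smaller sets `K A` of norm close to `D` form a Cauchy sequence, whose limit
  -- does not depend on the choices made.
  have hη : ∀ n : ℕ, (0 : ℝ) < 1 / (n + 1) := fun n => by positivity
  choose A hA ε hε hAε using fun n : ℕ => hclose (1 / (n + 1)) (hη n)
  let B : ℕ → Set ι := fun n => ⋂ k ∈ Finset.range (n + 1), A k
  have hBF : ∀ n, B n ∈ F := fun n => (biInter_finset_mem _).2 fun k _ => hA k
  have hBA : ∀ {k n}, k ≤ n → B n ⊆ A k := fun hkn =>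
    Set.biInter_subset_of_mem (Finset.mem_coe.2 (Finset.mem_range.2 (Nat.lt_succ_of_le hkn)))
  let e : ℕ → ℝ := fun n => (Finset.range (n + 1)).inf' ⟨0, by simp⟩ ε
  have he0 : ∀ n, 0 < e n := fun n => (Finset.lt_inf'_iff _).2 fun k _ => hε k
  have heε : ∀ {k n}, k ≤ n → e n ≤ ε k := fun hkn =>
    Finset.inf'_le _ (Finset.mem_range.2 (Nat.lt_succ_of_le hkn))
  choose y hyK hyD using fun n => hex (B n) (hBF n) (e n) (he0 n)
  have hyA : ∀ {k n}, k ≤ n → y n ∈ K (A k) ∧ ‖y n‖ ≤ D + ε k := fun hkn =>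
    ⟨hKmono (hBA hkn) (hyK _), (hyD _).trans (by gcongr; exact heε hkn)⟩
  have hlim0 : Tendsto (fun n : ℕ => (1 : ℝ) / (n + 1)) atTop (𝓝 0) :=
    tendsto_one_div_add_atTop_nhds_zero_nat
  have hcau : CauchySeq y := cauchySeq_of_le_tendsto_0 _ (fun n m N hn hm => by
    rw [dist_eq_norm]
    exact hAε N _ (hyA hn).1 _ (hyA hm).1 (hyA hn).2 (hyA hm).2) hlim0
  obtain ⟨l, hl⟩ := cauchySeq_tendsto_of_complete hcau
  refine ⟨l, fun G hG => ?_⟩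
  choose z hzK hzD using fun n => hex (G ∩ B n) (inter_mem hG (hBF n)) (e n) (he0 n)
  have hzl : Tendsto z atTop (𝓝 l) := by
    refine tendsto_of_tendsto_of_dist hl ?_
    refine squeeze_zero (fun _ => dist_nonneg) (fun n => ?_) hlim0
    rw [dist_eq_norm]
    exact hAε n _ (hyA le_rfl).1 _ (hKmono (Set.inter_subset_right.trans (hBA le_rfl)) (hzK n))
      (hyA le_rfl).2 ((hzD n).trans (by gcongr; exact heε le_rfl))
  exact isClosed_closure.mem_of_tendsto hzl
    (Eventually.of_forall fun n => hKmono Set.inter_subset_left (hzK n))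

theorem exists_ultrafilter_weak_limit [CompleteSpace E] [UniformConvexSpace E]
    {ι : Type*} (F : Ultrafilter ι) (x : ι → E) {C : ℝ} (hx : ∀ i, ‖x i‖ ≤ C) :
    ∃ l ∈ closure (convexHull ℝ (Set.range x)),
      ∀ f : E →L[ℝ] ℝ, Tendsto (fun i => f (x i)) F (𝓝 (f l)) := by
  obtain ⟨l, hl⟩ := exists_mem_of_filter_closedConvex (F := (F : Filter ι)) x hx
  refine ⟨l, by simpa using hl Set.univ univ_mem, fun f => ?_⟩
  have hcpt : IsCompact (Metric.closedBall (0 : ℝ) (‖f‖ * C)) := isCompact_closedBall _ _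
  obtain ⟨a, -, ha⟩ := hcpt.ultrafilter_le_nhds (F.map fun i => f (x i)) (by
    refine le_principal_iff.2 (Filter.mem_map.2 (univ_mem' fun i => ?_))
    simpa using (f.le_opNorm (x i)).trans (by gcongr; exact hx i))
  have ha' : Tendsto (fun i => f (x i)) F (𝓝 a) := ha
  suffices f l = a by rwa [this]
  refine eq_of_forall_dist_le fun ε hε => ?_
  have hA := ha'.eventually (Metric.closedBall_mem_nhds a hε)
  have hsub : closure (convexHull ℝ (x '' {i | f (x i) ∈ Metric.closedBall a ε})) ⊆
      f ⁻¹' Metric.closedBall a ε :=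
    closure_minimal (convexHull_min (by rintro _ ⟨i, hi, rfl⟩; exact hi)
      ((convex_closedBall a ε).linear_preimage f.toLinearMap))
      (Metric.isClosed_closedBall.preimage f.continuous)
  exact hsub (hl _ hA)

/-- Weak sequential compactness of bounded sets in uniformly convex Banach spaces. -/
theorem exists_weaklyConverges_subseq [CompleteSpace E] [UniformConvexSpace E]
    {x : ℕ → E} {C : ℝ} (hx : ∀ n, ‖x n‖ ≤ C) :
    ∃ (l : E) (k : ℕ → ℕ), StrictMono k ∧ WeaklyConverges (x ∘ k) l := by
  -- The limits of all subsequences lie in one separable subspace, whose points are separated by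
  -- countably many functionals.
  let W : Submodule ℝ E := (Submodule.span ℝ (Set.range x)).topologicalClosure
  have hWsep : TopologicalSpace.IsSeparable (W : Set E) :=
    ((Set.countable_range x).isSeparable.span (R := ℝ)).closure
  obtain ⟨c, hcc, hcW⟩ := hWsep
  have hcne : c.Nonempty := by
    rw [Set.nonempty_iff_ne_empty]
    rintro rfl
    simpa using hcW W.zero_mem
  obtain ⟨e, rfl⟩ := hcc.exists_eq_range hcne
  choose f hf1 hf2 using fun n => exists_dual_vector'' ℝ (e n)
  have hsep : ∀ v ∈ W, (∀ n, f n v = 0) → v = 0 := by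
    intro v hv hfv
    by_contra hne
    have hpos : 0 < ‖v‖ := norm_pos_iff.2 hne
    obtain ⟨_, ⟨n, rfl⟩, hn⟩ := Metric.mem_closure_iff.1 (hcW hv) (‖v‖ / 2) (by positivity)
    rw [dist_eq_norm] at hn
    have h1 : ‖e n‖ ≤ ‖v - e n‖ := by
      have h2 : f n (e n) = f n (e n - v) := by rw [map_sub, hfv, sub_zero]
      have h3 : ‖e n‖ = f n (e n) := (hf2 n).symm
      rw [h3, h2, norm_sub_rev]
      exact (le_abs_self _).trans (((f n).le_opNorm _).trans
        (by nlinarith [norm_nonneg (e n - v), hf1 n]))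
    have h2 : ‖v‖ ≤ ‖v - e n‖ + ‖e n‖ := by simpa using norm_add_le (v - e n) (e n)
    linarith
  have hcpt : IsSeqCompact (Set.univ.pi fun n : ℕ => Metric.closedBall (0 : ℝ) (‖f n‖ * C)) :=
    (isCompact_univ_pi fun n => isCompact_closedBall _ _).isSeqCompact
  obtain ⟨a, -, k, hk, ha⟩ := hcpt (x := fun m n => f n (x m)) fun m n _ => by
    simpa using ((f n).le_opNorm (x m)).trans (by gcongr; exact hx m)
  rw [tendsto_pi_nhds] at ha
  have hex : ∀ F : Ultrafilter ℕ, ∃ l ∈ W,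
      ∀ g : E →L[ℝ] ℝ, Tendsto (fun i => g ((x ∘ k) i)) F (𝓝 (g l)) := by
    intro F
    obtain ⟨l, hl, h⟩ := exists_ultrafilter_weak_limit F (x ∘ k) fun i => hx (k i)
    refine ⟨l, closure_mono ?_ hl, h⟩
    exact convexHull_min ((Set.range_comp_subset_range k x).trans Submodule.subset_span)
      (Submodule.convex _)
  choose L hLW hL using hex
  have hLa : ∀ F : Ultrafilter ℕ, (F : Filter ℕ) ≤ atTop → ∀ n, f n (L F) = a n :=
    fun F hF n => tendsto_nhds_unique (hL F (f n)) ((ha n).mono_left hF)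
  -- All ultrafilter limits agree, so the sequence converges.
  let F₀ : Ultrafilter ℕ := Ultrafilter.of atTop
  refine ⟨L F₀, k, hk, weaklyConverges_iff.2 fun g => ?_⟩
  rw [tendsto_iff_ultrafilter]
  intro F hF
  have : L F = L F₀ := sub_eq_zero.1 (hsep _ (W.sub_mem (hLW F) (hLW F₀)) fun n => by
    rw [map_sub, hLa F hF, hLa F₀ (Ultrafilter.of_le _), sub_self])
  rw [← this]
  exact hL F g

end WeakConvergence

/-! ### Convexity and smoothness of powers of the norm -/

section PowerNorm

variable {E : Type*} [NormedAddCommGroup E] [NormedSpace ℝ E]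

theorem norm_half_smul_add_rpow_lt [StrictConvexSpace ℝ E] {p : ℝ} (hp : 1 < p) {x y : E}
    (hxy : x ≠ y) :
    ‖(1 / 2 : ℝ) • x + (1 / 2 : ℝ) • y‖ ^ p < (‖x‖ ^ p + ‖y‖ ^ p) / 2 := by
  have hp0 : 0 < p := by linarith
  rcases eq_or_ne ‖x‖ ‖y‖ with h | h
  · have := norm_combo_lt_of_ne h.le le_rfl hxy (a := 1 / 2) (b := 1 / 2) (by norm_num)
      (by norm_num) (by norm_num)
    rw [h, add_self_div_two]
    exact Real.rpow_lt_rpow (norm_nonneg _) this hp0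
  · have h1 := (strictConvexOn_rpow hp).2 (Set.mem_Ici.2 (norm_nonneg x))
      (Set.mem_Ici.2 (norm_nonneg y)) h one_half_pos one_half_pos (add_halves 1)
    simp only [smul_eq_mul] at h1
    have h2 : ‖(1 / 2 : ℝ) • x + (1 / 2 : ℝ) • y‖ ≤ 1 / 2 * ‖x‖ + 1 / 2 * ‖y‖ := by
      refine (norm_add_le _ _).trans ?_
      rw [norm_smul, norm_smul, Real.norm_of_nonneg (by norm_num)]
    have h3 := Real.rpow_le_rpow (norm_nonneg _) h2 hp0.le
    linarith

theorem norm_half_smul_add_rpow_le [StrictConvexSpace ℝ E] {p : ℝ} (hp : 1 < p) (x y : E) :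
    ‖(1 / 2 : ℝ) • x + (1 / 2 : ℝ) • y‖ ^ p ≤ (‖x‖ ^ p + ‖y‖ ^ p) / 2 := by
  rcases eq_or_ne x y with rfl | h
  · rw [← add_smul, add_self_div_two]
    norm_num
  · exact (norm_half_smul_add_rpow_lt hp h).le

theorem UniformSmoothSpace.norm_add_add_norm_sub_le [UniformSmoothSpace E] {ε : ℝ} (hε : 0 < ε) :
    ∃ δ : ℝ, 0 < δ ∧ ∀ x h : E, ‖h‖ ≤ δ * ‖x‖ → ‖x + h‖ + ‖x - h‖ ≤ 2 * ‖x‖ + ε * ‖h‖ := by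
  obtain ⟨δ, hδ, H⟩ := UniformSmoothSpace.uniform_smooth (E := E) ε hε
  refine ⟨δ, hδ, fun x h hh => ?_⟩
  rcases eq_or_ne x 0 with rfl | hx
  · have : h = 0 := norm_le_zero_iff.1 (by simpa using hh)
    simp [this]
  have hx0 : 0 < ‖x‖ := norm_pos_iff.2 hx
  have hs : ∀ v : E, ‖‖x‖⁻¹ • v‖ = ‖x‖⁻¹ * ‖v‖ := fun v => by
    rw [norm_smul, norm_inv, norm_norm]
  have h1 := H (‖x‖⁻¹ • x) (‖x‖⁻¹ • h) (by rw [hs, inv_mul_cancel₀ hx0.ne'])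
    (by rw [hs, inv_mul_le_iff₀ hx0, mul_comm]; exact hh)
  rw [← smul_add, ← smul_sub, hs, hs, hs] at h1
  have h2 := mul_le_mul_of_nonneg_left h1 hx0.le
  have e1 : ‖x‖ * (‖x‖⁻¹ * ‖x + h‖ + ‖x‖⁻¹ * ‖x - h‖) = ‖x + h‖ + ‖x - h‖ := by field_simp
  have e2 : ‖x‖ * (2 + ε * (‖x‖⁻¹ * ‖h‖)) = 2 * ‖x‖ + ε * ‖h‖ := by field_simp
  rwa [e1, e2] at h2

/-- Uniform smoothness of `‖·‖ ^ p` on the unit ball, including near the origin. -/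
theorem UniformSmoothSpace.norm_rpow_add_le [UniformSmoothSpace E] {p : ℝ} (hp : 1 < p)
    {ε : ℝ} (hε : 0 < ε) :
    ∃ δ : ℝ, 0 < δ ∧ ∀ x h : E, ‖x‖ ≤ 1 → ‖h‖ ≤ δ →
      ‖x + h‖ ^ p + ‖x - h‖ ^ p ≤ 2 * ‖x‖ ^ p + ε * ‖h‖ := by
  have hp0 : 0 < p := by linarith
  -- Tangent inequality for the convex function `t ↦ t ^ p`.
  have htan : ∀ a s : ℝ, 0 ≤ a → 0 ≤ s → a ^ p - s ^ p ≤ p * a ^ (p - 1) * (a - s) := by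
    intro a s ha hs
    have hd : HasDerivAt (fun t : ℝ => t ^ p) (p * a ^ (p - 1)) a :=
      Real.hasDerivAt_rpow_const (Or.inr hp.le)
    have hc := convexOn_rpow hp.le
    rcases lt_trichotomy a s with h | rfl | h
    · have := hc.le_slope_of_hasDerivAt ha hs h hd
      rw [slope_def_field, le_div_iff₀ (by linarith)] at this
      linarith
    · simp
    · have := hc.slope_le_of_hasDerivAt hs ha h hd
      rw [slope_def_field, div_le_iff₀ (by linarith)] at this
      linarith
  have hcont : ContinuousOn (fun t : ℝ => t ^ (p - 1)) (Set.Icc 0 2) :=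
    (Real.continuous_rpow_const (by linarith)).continuousOn
  have huc := isCompact_Icc.uniformContinuousOn_of_continuous hcont
  rw [Metric.uniformContinuousOn_iff] at huc
  obtain ⟨τ, hτ, huc⟩ := huc (ε / (4 * p)) (by positivity)
  obtain ⟨δ₁, hδ₁, H⟩ := UniformSmoothSpace.norm_add_add_norm_sub_le (E := E)
    (ε := ε / (2 * p)) (by positivity)
  -- Where `‖x‖` is below `τ / 2`, the derivative of `t ↦ t ^ p` is small already.
  refine ⟨min (min (τ / 2) 1) (δ₁ * (τ / 2)), by positivity, fun x h hx hh => ?_⟩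
  have hh1 : ‖h‖ ≤ τ / 2 := hh.trans ((min_le_left _ _).trans (min_le_left _ _))
  have hh2 : ‖h‖ ≤ 1 := hh.trans ((min_le_left _ _).trans (min_le_right _ _))
  have hh3 : ‖h‖ ≤ δ₁ * (τ / 2) := hh.trans (min_le_right _ _)
  have hs0 := norm_nonneg x
  have hh0 := norm_nonneg h
  have hstep : ∀ a : ℝ, 0 ≤ a → |a - ‖x‖| ≤ ‖h‖ →
      a ^ p - ‖x‖ ^ p ≤ p * ‖x‖ ^ (p - 1) * (a - ‖x‖) + ε / 4 * ‖h‖ := by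
    intro a ha hax
    have h1 := huc a ⟨ha, by linarith [(abs_le.1 hax).2]⟩ ‖x‖ ⟨hs0, by linarith⟩
      (by rw [Real.dist_eq]; linarith)
    rw [Real.dist_eq] at h1
    have h2 : (a ^ (p - 1) - ‖x‖ ^ (p - 1)) * (a - ‖x‖) ≤ ε / (4 * p) * ‖h‖ := by
      refine (le_abs_self _).trans ?_
      rw [abs_mul]
      exact mul_le_mul h1.le hax (abs_nonneg _) (by positivity)
    have h3 := mul_le_mul_of_nonneg_left h2 hp0.le
    have e : p * (ε / (4 * p) * ‖h‖) = ε / 4 * ‖h‖ := by field_simp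
    have := htan a ‖x‖ ha hs0
    linarith
  have ha : |‖x + h‖ - ‖x‖| ≤ ‖h‖ := by simpa using abs_norm_sub_norm_le (x + h) x
  have hb : |‖x - h‖ - ‖x‖| ≤ ‖h‖ := by simpa using abs_norm_sub_norm_le (x - h) x
  have h1 := hstep _ (norm_nonneg _) ha
  have h2 := hstep _ (norm_nonneg _) hb
  have hmain : p * ‖x‖ ^ (p - 1) * (‖x + h‖ + ‖x - h‖ - 2 * ‖x‖) ≤ ε / 2 * ‖h‖ := by
    rcases le_or_gt (τ / 2) ‖x‖ with hτx | hτx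
    · have h3 := H x h (hh3.trans (by gcongr))
      have h4 : ‖x‖ ^ (p - 1) ≤ 1 := Real.rpow_le_one hs0 hx (by linarith)
      have h5 : p * ‖x‖ ^ (p - 1) ≤ p := by nlinarith
      calc _ ≤ p * ‖x‖ ^ (p - 1) * (ε / (2 * p) * ‖h‖) := by gcongr; linarith
        _ ≤ p * (ε / (2 * p) * ‖h‖) := by gcongr
        _ = ε / 2 * ‖h‖ := by field_simp
    · have h3 := huc ‖x‖ ⟨hs0, by linarith⟩ 0 (by simp) (by
        rw [Real.dist_eq, sub_zero, abs_of_nonneg hs0]; linarith)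
      rw [Real.dist_eq, Real.zero_rpow (by linarith), sub_zero,
        abs_of_nonneg (Real.rpow_nonneg hs0 _)] at h3
      have h4 := (abs_le.1 ha).2
      have h5 := (abs_le.1 hb).2
      calc _ ≤ p * ‖x‖ ^ (p - 1) * (2 * ‖h‖) := by gcongr; linarith
        _ ≤ p * (ε / (4 * p)) * (2 * ‖h‖) := by gcongr
        _ = ε / 2 * ‖h‖ := by field_simp; ring
  linarith

end PowerNorm

/-! ### Geometry of the `ℓ^q`-sum of two spaces -/

section ProdLp

open scoped ENNReal

theorem WithLp.prod_norm_rpow {Y U : Type*} [NormedAddCommGroup Y] [NormedAddCommGroup U]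
    {q : ℝ≥0∞} (hq : 0 < q.toReal) (z : WithLp q (Y × U)) :
    ‖z‖ ^ q.toReal = ‖z.fst‖ ^ q.toReal + ‖z.snd‖ ^ q.toReal := by
  rw [WithLp.prod_norm_eq_add hq, ← Real.rpow_mul (by positivity), one_div,
    inv_mul_cancel₀ hq.ne', Real.rpow_one]

variable {Y U : Type*} [NormedAddCommGroup Y] [NormedSpace ℝ Y] [NormedAddCommGroup U]
  [NormedSpace ℝ U] {q : ℝ≥0∞} [Fact (1 ≤ q)]

theorem WithLp.prod_strictConvexSpace (hq : 1 < q.toReal) [StrictConvexSpace ℝ Y]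
    [StrictConvexSpace ℝ U] : StrictConvexSpace ℝ (WithLp q (Y × U)) := by
  refine StrictConvexSpace.of_norm_combo_lt_one fun x y hx hy hxy =>
    ⟨1 / 2, 1 / 2, by norm_num, ?_⟩
  have hq0 : 0 < q.toReal := by linarith
  rw [← Real.rpow_lt_rpow_iff (norm_nonneg _) zero_le_one hq0, WithLp.prod_norm_rpow hq0,
    Real.one_rpow]
  have hx' := WithLp.prod_norm_rpow hq0 x
  have hy' := WithLp.prod_norm_rpow hq0 y
  rw [hx, Real.one_rpow] at hx'
  rw [hy, Real.one_rpow] at hy'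
  simp only [WithLp.add_fst, WithLp.add_snd, WithLp.smul_fst, WithLp.smul_snd]
  by_cases h : x.fst = y.fst
  · have h2 : x.snd ≠ y.snd := fun h2 => hxy (WithLp.ofLp_injective q (Prod.ext h h2))
    have := norm_half_smul_add_rpow_le hq x.fst y.fst
    have := norm_half_smul_add_rpow_lt hq h2
    linarith
  · have := norm_half_smul_add_rpow_lt hq h
    have := norm_half_smul_add_rpow_le hq x.snd y.snd
    linarith

theorem WithLp.prod_uniformSmoothSpace (hq : 1 < q.toReal) [UniformSmoothSpace Y]
    [UniformSmoothSpace U] : UniformSmoothSpace (WithLp q (Y × U)) := by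
  refine ⟨fun ε hε => ?_⟩
  have hq0 : 0 < q.toReal := by linarith
  obtain ⟨δ₁, hδ₁, H₁⟩ := UniformSmoothSpace.norm_rpow_add_le (E := Y) hq (half_pos hε)
  obtain ⟨δ₂, hδ₂, H₂⟩ := UniformSmoothSpace.norm_rpow_add_le (E := U) hq (half_pos hε)
  refine ⟨min δ₁ δ₂, lt_min hδ₁ hδ₂, fun x h hx hh => ?_⟩
  have hx1 : ‖x.fst‖ ≤ 1 := hx ▸ WithLp.norm_fst_le _ x
  have hx2 : ‖x.snd‖ ≤ 1 := hx ▸ WithLp.norm_snd_le _ x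
  have hh1 : ‖h.fst‖ ≤ ‖h‖ := WithLp.norm_fst_le _ h
  have hh2 : ‖h.snd‖ ≤ ‖h‖ := WithLp.norm_snd_le _ h
  have h1 := H₁ x.fst h.fst hx1 (hh1.trans (hh.trans (min_le_left _ _)))
  have h2 := H₂ x.snd h.snd hx2 (hh2.trans (hh.trans (min_le_right _ _)))
  have hs := WithLp.prod_norm_rpow hq0 x
  rw [hx, Real.one_rpow] at hs
  have hsum : ‖x + h‖ ^ q.toReal + ‖x - h‖ ^ q.toReal ≤ 2 + ε * ‖h‖ := by
    rw [WithLp.prod_norm_rpow hq0, WithLp.prod_norm_rpow hq0]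
    simp only [WithLp.add_fst, WithLp.add_snd, WithLp.sub_fst, WithLp.sub_snd]
    nlinarith
  -- Bernoulli's inequality turns the bound on the powers into a bound on the norms.
  have hbern : ∀ t : ℝ, 0 ≤ t → 1 + q.toReal * (t - 1) ≤ t ^ q.toReal := fun t ht => by
    have := one_add_mul_self_le_rpow_one_add (show -1 ≤ t - 1 by linarith) hq.le
    rwa [add_sub_cancel] at this
  have h3 := hbern _ (norm_nonneg (x + h))
  have h4 := hbern _ (norm_nonneg (x - h))
  have h5 : 0 ≤ ε * ‖h‖ := by positivity
  by_contra! hlt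
  nlinarith

end ProdLp

/-! ### Nearest points -/

section NearestPoints

variable {X : Type*} [NormedAddCommGroup X] {M : Set X}

/-- A set is *approximatively compact* if every minimizing sequence for the distance to a point
has a subsequence that converges in norm to an element of the set. -/
def ApproximativelyCompact (M : Set X) : Prop :=
  ∀ (x : X) (z : ℕ → X), (∀ n, z n ∈ M) →
    Tendsto (fun n => ‖x - z n‖) atTop (𝓝 (Metric.infDist x M)) →
    ∃ (l : X) (k : ℕ → ℕ), l ∈ M ∧ StrictMono k ∧ Tendsto (z ∘ k) atTop (𝓝 l)

theorem ApproximativelyCompact.exists_nearest (hM : ApproximativelyCompact M) (hne : M.Nonempty)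
    (x : X) : ∃ z ∈ M, ‖x - z‖ = Metric.infDist x M := by
  have hex : ∀ n : ℕ, ∃ z ∈ M, dist x z < Metric.infDist x M + 1 / (n + 1) := fun n =>
    (Metric.infDist_lt_iff hne).1 (lt_add_of_pos_right _ (by positivity))
  choose z hzM hz using hex
  have hlim : Tendsto (fun n => ‖x - z n‖) atTop (𝓝 (Metric.infDist x M)) := by
    refine tendsto_of_tendsto_of_tendsto_of_le_of_le tendsto_const_nhds
      (by simpa using tendsto_const_nhds.add (tendsto_one_div_add_atTop_nhds_zero_nat (𝕜 := ℝ)))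
      (fun n => ?_) (fun n => ?_)
    · rw [← dist_eq_norm]; exact Metric.infDist_le_dist_of_mem (hzM n)
    · rw [← dist_eq_norm, inv_eq_one_div]; exact (hz n).le
  obtain ⟨l, k, hl, hk, hkl⟩ := hM x z hzM hlim
  exact ⟨l, hl, tendsto_nhds_unique (tendsto_const_nhds.sub hkl).norm
    (hlim.comp hk.tendsto_atTop)⟩

/-- The metric projection onto an approximatively compact set is continuous where nearest points
are unique. -/
theorem ApproximativelyCompact.continuous_projection (hM : ApproximativelyCompact M) {P : X → X}
    (hPM : ∀ x, P x ∈ M) (hPd : ∀ x, ‖x - P x‖ = Metric.infDist x M)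
    (huniq : ∀ x, ∀ z ∈ M, ‖x - z‖ = Metric.infDist x M → z = P x) : Continuous P := by
  rw [continuous_iff_continuousAt]
  intro x
  refine tendsto_of_seq_tendsto fun u hu => tendsto_of_subseq_tendsto fun s hs => ?_
  have hus := hu.comp hs
  have hlim : Tendsto (fun n => ‖x - P (u (s n))‖) atTop (𝓝 (Metric.infDist x M)) := by
    have h1 : Tendsto (fun n => ‖u (s n) - P (u (s n))‖) atTop (𝓝 (Metric.infDist x M)) := by
      simp_rw [hPd]
      exact ((Metric.continuous_infDist_pt M).tendsto x).comp hus
    refine h1.congr_dist (squeeze_zero (fun _ => dist_nonneg) (fun n => ?_)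
      (tendsto_iff_dist_tendsto_zero.1 hus))
    rw [Real.dist_eq, dist_eq_norm]
    exact (abs_norm_sub_norm_le _ _).trans (by rw [sub_sub_sub_cancel_right]; rfl)
  obtain ⟨l, k, hl, hk, hkl⟩ := hM x _ (fun n => hPM (u (s n))) hlim
  have : l = P x := huniq x l hl (tendsto_nhds_unique (tendsto_const_nhds.sub hkl).norm
    (hlim.comp hk.tendsto_atTop))
  exact ⟨k, this ▸ hkl⟩

/-- In a strictly convex space, a nearest point of `d` is the only nearest point of every
other point on the segment that joins it to `d`. -/
theorem eq_of_norm_sub_lineMap_le [NormedSpace ℝ X] [StrictConvexSpace ℝ X] {d z w : X}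
    (hz : ‖d - z‖ ≤ ‖d - w‖) {t : ℝ} (ht0 : 0 < t) (ht1 : t ≤ 1)
    (h : ‖AffineMap.lineMap d z t - w‖ ≤ ‖AffineMap.lineMap d z t - z‖) : w = z := by
  set a := AffineMap.lineMap d z t with ha
  have e1 : a - z = (1 - t) • (d - z) := by rw [ha, AffineMap.lineMap_apply_module]; module
  have e2 : d - a = t • (d - z) := by rw [ha, AffineMap.lineMap_apply_module]; module
  have n1 : ‖a - z‖ = (1 - t) * ‖d - z‖ := by
    rw [e1, norm_smul, Real.norm_of_nonneg (by linarith)]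
  have n2 : ‖d - a‖ = t * ‖d - z‖ := by rw [e2, norm_smul, Real.norm_of_nonneg ht0.le]
  have tri : ‖d - w‖ ≤ ‖d - a‖ + ‖a - w‖ := by
    simpa using norm_add_le (d - a) (a - w)
  have n3 : ‖a - w‖ = (1 - t) * ‖d - z‖ := by linarith
  rcases eq_or_ne d z with rfl | hdz
  · rw [sub_self, norm_zero, mul_zero] at n3
    have hda : d - a = 0 := by rw [e2, sub_self, smul_zero]
    rw [← sub_eq_zero.1 (norm_eq_zero.1 n3), ← sub_eq_zero.1 hda]
  · have ray : SameRay ℝ (d - a) (a - w) := by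
      rw [sameRay_iff_norm_add, sub_add_sub_cancel]
      linarith
    have ray' : SameRay ℝ (d - z) (a - w) := by
      rw [e2] at ray
      exact (SameRay.sameRay_pos_smul_left (d - z) ht0).symm.trans ray fun h0 => by
        simp [ht0.ne', sub_ne_zero.2 hdz] at h0
    have h0 := ray'.norm_smul_eq
    rw [n3, mul_comm, mul_smul, ← e1] at h0
    have := smul_right_injective X (norm_ne_zero_iff.2 (sub_ne_zero.2 hdz)) h0
    exact sub_right_injective this

theorem norm_sub_lineMap_le [NormedSpace ℝ X] {d z w : X} (hz : ‖d - z‖ ≤ ‖d - w‖) {t : ℝ}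
    (ht0 : 0 ≤ t) (ht1 : t ≤ 1) :
    ‖AffineMap.lineMap d z t - z‖ ≤ ‖AffineMap.lineMap d z t - w‖ := by
  have n1 : ‖AffineMap.lineMap d z t - z‖ = (1 - t) * ‖d - z‖ := by
    rw [← dist_eq_norm, dist_lineMap_right, Real.norm_of_nonneg (by linarith), dist_eq_norm]
  have n2 : ‖d - AffineMap.lineMap d z t‖ = t * ‖d - z‖ := by
    rw [← dist_eq_norm, dist_left_lineMap, Real.norm_of_nonneg ht0, dist_eq_norm]
  have tri := norm_add_le (d - AffineMap.lineMap d z t) (AffineMap.lineMap d z t - w)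
  rw [sub_add_sub_cancel] at tri
  linarith

end NearestPoints

/-! ### Midpoint affine maps -/

section AffineLinear

variable {U Y : Type*} [NormedAddCommGroup U] [NormedSpace ℝ U] [NormedAddCommGroup Y]
  [NormedSpace ℝ Y]

/-- For weakly continuous maps, midpoint affine maps are affine-linear. -/
theorem isAffineLinear_of_map_midpoint {S : U → Y} (hSw : WeakToWeakContinuous S)
    (hmid : ∀ u v, S (midpoint ℝ u v) = midpoint ℝ (S u) (S v)) : IsAffineLinear S := by
  have hhalf : ∀ u, S ((2⁻¹ : ℝ) • u) = (2⁻¹ : ℝ) • (S u + S 0) := fun u => by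
    have := hmid u 0
    rwa [midpoint_eq_smul_add, midpoint_eq_smul_add, add_zero, invOf_eq_inv] at this
  let T : U →+ Y := AddMonoidHom.mk' (fun u => S u - S 0) fun u v => by
    have h1 := hhalf (u + v)
    have h2 := hmid u v
    rw [midpoint_eq_smul_add, midpoint_eq_smul_add, invOf_eq_inv, h1] at h2
    have h3 : S (u + v) + S 0 = S u + S v := smul_right_injective Y (by norm_num) h2
    rw [eq_sub_of_add_eq h3]
    abel
  have hT : ∀ u, T u = S u - S 0 := fun _ => rfl
  refine ⟨{ toFun := T, map_add' := T.map_add, map_smul' := fun c u => ?_ }, S 0, fun u => ?_⟩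
  · refine (SeparatingDual.eq_iff_forall_dual_eq (R := ℝ)).2 fun f => ?_
    let g : ℝ →+ ℝ := (f.toLinearMap.toAddMonoidHom.comp T).comp
      ((LinearMap.toSpanSingleton ℝ U u).toAddMonoidHom)
    have hg : ∀ t, g t = f (S (t • u)) - f (S 0) := fun t => by
      rw [← map_sub]; rfl
    have hgc : Continuous g := by
      rw [continuous_iff_seqContinuous]
      intro t t₀ ht
      have hw : WeaklyConverges (fun n => t n • u) (t₀ • u) :=
        (ht.smul_const u).weaklyConverges
      simp only [Function.comp_def, hg]
      exact (weaklyConverges_iff.1 (hSw _ _ hw) f).sub_const _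
    have := map_real_smul g hgc c 1
    simpa [g] using this
  · simp [hT]

end AffineLinear

/-! ### The graph as a subset of the `ℓ^q`-sum -/

section Graph

open scoped ENNReal

variable {U Y : Type*} [NormedAddCommGroup U] [NormedAddCommGroup Y]

/-- The graph of `S : U → Y` in the `ℓ^q`-sum of `Y` and `U`, with the value in the first
component. -/
def lpGraph (q : ℝ≥0∞) (S : U → Y) : Set (WithLp q (Y × U)) := {z | z.fst = S z.snd}

/-- If the sum of two sequences tends to at most `a + b` and their lower limits are at least `a`
and `b`, then the first converges to `a`. -/
theorem tendsto_of_tendsto_add {s t : ℕ → ℝ} {a b c : ℝ}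
    (hsum : Tendsto (fun n => s n + t n) atTop (𝓝 c)) (hc : c ≤ a + b)
    (hs : ∀ r < a, ∀ᶠ n in atTop, r < s n) (ht : ∀ r < b, ∀ᶠ n in atTop, r < t n) :
    Tendsto s atTop (𝓝 a) := by
  refine tendsto_order.2 ⟨hs, fun r hr => ?_⟩
  filter_upwards [ht (b - (r - a) / 2) (by linarith),
    hsum.eventually (gt_mem_nhds (show c < a + b + (r - a) / 2 by linarith))] with n h1 h2
  linarith

theorem WeaklyConverges.eventually_lt_norm_rpow {E : Type*} [NormedAddCommGroup E]
    [NormedSpace ℝ E] {x : ℕ → E} {l : E} (h : WeaklyConverges x l) {p : ℝ} (hp : 0 < p) {r : ℝ}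
    (hr : r < ‖l‖ ^ p) : ∀ᶠ n in atTop, r < ‖x n‖ ^ p := by
  rcases lt_or_ge r 0 with h0 | h0
  · exact Eventually.of_forall fun n => h0.trans_le (by positivity)
  have hr' : r ^ p⁻¹ < ‖l‖ := (Real.rpow_inv_lt_iff_of_pos h0 (norm_nonneg _) hp).2 hr
  filter_upwards [h.eventually_lt_norm hr'] with n hn
  exact (Real.rpow_inv_lt_iff_of_pos h0 (norm_nonneg _) hp).1 hn

theorem WeaklyConverges.tendsto_of_norm_rpow {E : Type*} [NormedAddCommGroup E]
    [NormedSpace ℝ E] [UniformConvexSpace E] {x : ℕ → E} {l : E} (h : WeaklyConverges x l) {p : ℝ}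
    (hp : 0 < p) (hn : Tendsto (fun n => ‖x n‖ ^ p) atTop (𝓝 (‖l‖ ^ p))) :
    Tendsto x atTop (𝓝 l) := by
  refine h.tendsto_of_norm ?_
  have := hn.rpow_const (p := p⁻¹) (Or.inr (by positivity))
  simpa [Real.rpow_rpow_inv, hp.ne'] using this

theorem approximativelyCompact_lpGraph [NormedSpace ℝ U] [NormedSpace ℝ Y]
    [CompleteSpace U] [UniformConvexSpace U]
    [UniformConvexSpace Y] {q : ℝ≥0∞} [Fact (1 ≤ q)] (hq : 0 < q.toReal) {S : U → Y}
    (hSw : WeakToWeakContinuous S) : ApproximativelyCompact (lpGraph q S) := by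
  intro x z hz hlim
  obtain ⟨C, hC⟩ := hlim.bddAbove_range
  have hbd : ∀ n, ‖(z n).snd‖ ≤ ‖x‖ + C := fun n => by
    have h1 : ‖x - z n‖ ≤ C := hC ⟨n, rfl⟩
    have h2 := norm_sub_le x (x - z n)
    rw [sub_sub_cancel] at h2
    exact (WithLp.norm_snd_le _ (z n)).trans (by linarith)
  obtain ⟨u, k, hk, hu⟩ := exists_weaklyConverges_subseq hbd
  have hy : WeaklyConverges (fun n => (z (k n)).fst) (S u) := by
    have := hSw _ _ hu
    rwa [show (fun n => S (((fun n => (z n).snd) ∘ k) n)) = fun n => (z (k n)).fst from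
      funext fun n => (hz (k n)).symm] at this
  have hu' : WeaklyConverges (fun n => (z (k n)).snd - x.snd) (u - x.snd) := by
    simpa only [sub_eq_add_neg, Function.comp_apply] using hu.add_const (-x.snd)
  have hy' : WeaklyConverges (fun n => (z (k n)).fst - x.fst) (S u - x.fst) := by
    simpa only [sub_eq_add_neg] using hy.add_const (-x.fst)
  let l : WithLp q (Y × U) := WithLp.toLp q (S u, u)
  have hl : l ∈ lpGraph q S := rfl
  have hdist : ∀ w : WithLp q (Y × U), ‖x - w‖ ^ q.toReal =
      ‖w.fst - x.fst‖ ^ q.toReal + ‖w.snd - x.snd‖ ^ q.toReal := fun w => by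
    rw [norm_sub_rev, WithLp.prod_norm_rpow hq]; rfl
  have hsum : Tendsto (fun n => ‖(z (k n)).fst - x.fst‖ ^ q.toReal +
      ‖(z (k n)).snd - x.snd‖ ^ q.toReal) atTop
      (𝓝 (Metric.infDist x (lpGraph q S) ^ q.toReal)) := by
    simp_rw [← hdist]
    exact (hlim.comp hk.tendsto_atTop).rpow_const (Or.inr hq.le)
  have hle : Metric.infDist x (lpGraph q S) ^ q.toReal ≤
      ‖S u - x.fst‖ ^ q.toReal + ‖u - x.snd‖ ^ q.toReal := by
    have h := Metric.infDist_le_dist_of_mem (x := x) hl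
    rw [dist_eq_norm] at h
    exact (Real.rpow_le_rpow Metric.infDist_nonneg h hq.le).trans_eq (hdist l)
  have h1 := hy'.tendsto_of_norm_rpow hq (tendsto_of_tendsto_add hsum hle
    (fun r => hy'.eventually_lt_norm_rpow hq) (fun r => hu'.eventually_lt_norm_rpow hq))
  have h2 := hu'.tendsto_of_norm_rpow hq (tendsto_of_tendsto_add
    (by simpa only [add_comm] using hsum) (by rwa [add_comm])
    (fun r => hu'.eventually_lt_norm_rpow hq) (fun r => hy'.eventually_lt_norm_rpow hq))
  refine ⟨l, k, hl, hk, ?_⟩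
  have h3 : Tendsto (fun n => ((z (k n)).fst, (z (k n)).snd)) atTop (𝓝 (S u, u)) := by
    refine Tendsto.prodMk_nhds ?_ ?_
    · simpa using h1.add_const x.fst
    · simpa using h2.add_const x.snd
  exact ((WithLp.prod_continuous_toLp q Y U).tendsto (S u, u)).comp h3

theorem mem_solutionSet_iff {p : ℝ} (hp : 0 < p) {q : ℝ≥0∞} [Fact (1 ≤ q)] (hqp : q.toReal = p)
    {S : U → Y} {d z : Y × U} : z ∈ solutionSet p S d ↔ WithLp.toLp q z ∈ lpGraph q S ∧
      ∀ w ∈ lpGraph q S, ‖WithLp.toLp q d - WithLp.toLp q z‖ ≤ ‖WithLp.toLp q d - w‖ := by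
  subst hqp
  have hobj : ∀ w : WithLp q (Y × U), trackingObjective q.toReal d (WithLp.ofLp w) =
      ‖WithLp.toLp q d - w‖ ^ q.toReal := fun w => by
    rw [norm_sub_rev, WithLp.prod_norm_rpow hp]; rfl
  have hle : ∀ w : WithLp q (Y × U), trackingObjective q.toReal d z ≤
      trackingObjective q.toReal d (WithLp.ofLp w) ↔
      ‖WithLp.toLp q d - WithLp.toLp q z‖ ≤ ‖WithLp.toLp q d - w‖ := fun w => by
    rw [hobj w, ← Real.rpow_le_rpow_iff (norm_nonneg _) (norm_nonneg _) hp]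
    exact (hobj (WithLp.toLp q z)).symm ▸ Iff.rfl
  exact and_congr Iff.rfl ⟨fun h w hw => (hle w).1 (h _ hw), fun h w hw => (hle _).2 (h _ hw)⟩

end Graph

/-! ### Instability of the tracking problem -/

section TrackingProblem

open scoped ENNReal

variable {Y U : Type*} [NormedAddCommGroup Y] [NormedSpace ℝ Y] [UniformConvexSpace Y]
  [NormedAddCommGroup U] [NormedSpace ℝ U] [UniformConvexSpace U]

/-- The graph of a weakly continuous map that is not affine-linear is not a Chebyshev set. -/
theorem exists_two_nearest_lpGraph [CompleteSpace Y] [UniformSmoothSpace Y] [CompleteSpace U]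
    [UniformSmoothSpace U] {q : ℝ≥0∞} [Fact (1 ≤ q)] (hq : 1 < q.toReal) {S : U → Y}
    (hS : ¬ IsAffineLinear S) (hSw : WeakToWeakContinuous S) :
    ∃ d : WithLp q (Y × U), ∃ z ∈ lpGraph q S, ∃ z' ∈ lpGraph q S, z ≠ z' ∧
      (∀ w ∈ lpGraph q S, ‖d - z‖ ≤ ‖d - w‖) ∧ ∀ w ∈ lpGraph q S, ‖d - z'‖ ≤ ‖d - w‖ := by
  have hM := approximativelyCompact_lpGraph (q := q) (by linarith) hSw
  have hne : (lpGraph q S).Nonempty := ⟨WithLp.toLp q (S 0, 0), rfl⟩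
  have hmin : ∀ d z, ‖d - z‖ = Metric.infDist d (lpGraph q S) →
      ∀ w ∈ lpGraph q S, ‖d - z‖ ≤ ‖d - w‖ := fun d z h w hw => by
    rw [h, ← dist_eq_norm]
    exact Metric.infDist_le_dist_of_mem hw
  choose P hPM hPd using hM.exists_nearest hne
  by_contra! hcon
  refine hS (isAffineLinear_of_map_midpoint hSw fun u v => ?_)
  have huniq : ∀ x, ∀ z ∈ lpGraph q S, ‖x - z‖ = Metric.infDist x (lpGraph q S) → z = P x := by
    intro x z hz hzd
    by_contra hzP
    obtain ⟨w, hw, hlt⟩ := hcon x z hz (P x) (hPM x) hzP (hmin x z hzd)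
    exact (hmin x (P x) (hPd x) w hw).not_gt hlt
  have := WithLp.prod_uniformSmoothSpace (Y := Y) (U := U) hq
  have hmem := midpoint_mem_of_continuous_projection hPM hPd
    (hM.continuous_projection hPM hPd huniq)
    (show WithLp.toLp q (S u, u) ∈ lpGraph q S from rfl)
    (show WithLp.toLp q (S v, v) ∈ lpGraph q S from rfl)
  simp only [lpGraph, Set.mem_ofPred_eq, midpoint_eq_smul_add, WithLp.smul_fst, WithLp.smul_snd,
    WithLp.add_fst, WithLp.add_snd] at hmem
  rw [midpoint_eq_smul_add, midpoint_eq_smul_add]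
  exact hmem.symm

/-- Moving the data `d` towards one of its solutions `z` makes `z` the unique solution. -/
theorem exists_tendsto_solutionSet_eq_singleton {p : ℝ} (hp : 1 < p) {q : ℝ≥0∞} [Fact (1 ≤ q)]
    (hqp : q.toReal = p) {S : U → Y} {d z : WithLp q (Y × U)} (hz : z ∈ lpGraph q S)
    (hmin : ∀ w ∈ lpGraph q S, ‖d - z‖ ≤ ‖d - w‖) :
    ∃ a : ℕ → Y × U, Tendsto a atTop (𝓝 (WithLp.ofLp d)) ∧
      ∀ n, solutionSet p S (a n) = {WithLp.ofLp z} := by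
  have hp0 : 0 < p := by linarith
  have := WithLp.prod_strictConvexSpace (Y := Y) (U := U) (hqp.symm ▸ hp)
  refine ⟨fun n => WithLp.ofLp (AffineMap.lineMap d z (1 / ((n : ℝ) + 1))), ?_, fun n => ?_⟩
  · have h1 : Tendsto (AffineMap.lineMap d z : ℝ → WithLp q (Y × U)) (𝓝 0) (𝓝 d) := by
      have : Continuous (AffineMap.lineMap d z : ℝ → WithLp q (Y × U)) :=
        AffineMap.lineMap_continuous
      simpa using this.tendsto 0
    exact ((WithLp.prod_continuous_ofLp q Y U).tendsto d).comp
      (h1.comp tendsto_one_div_add_atTop_nhds_zero_nat)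
  · have ht0 : (0 : ℝ) < 1 / ((n : ℝ) + 1) := by positivity
    have ht1 : (1 : ℝ) / ((n : ℝ) + 1) ≤ 1 := (div_le_one (by positivity)).2 (by simp)
    ext w
    rw [mem_solutionSet_iff hp0 hqp, Set.mem_singleton_iff]
    constructor
    · rintro ⟨hw, hwmin⟩
      rw [← eq_of_norm_sub_lineMap_le (hmin _ hw) ht0 ht1 (hwmin z hz)]
    · rintro rfl
      exact ⟨hz, fun w hw => norm_sub_lineMap_le (hmin w hw) ht0.le ht1⟩

end TrackingProblem

theorem theorem2p4 {Y U : Type*}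
    [NormedAddCommGroup Y] [NormedSpace ℝ Y] [CompleteSpace Y]
    [UniformConvexSpace Y] [UniformSmoothSpace Y]
    [NormedAddCommGroup U] [NormedSpace ℝ U] [CompleteSpace U]
    [UniformConvexSpace U] [UniformSmoothSpace U]
    (p : ℝ) (hp : 1 < p) (S : U → Y) (hS : ¬ IsAffineLinear S) (hSw : WeakToWeakContinuous S) :
    (∃ (d : Y × U) (a b : ℕ → Y × U) (z z' : Y × U),
      Tendsto a atTop (𝓝 d) ∧ Tendsto b atTop (𝓝 d) ∧
      (∀ n : ℕ, solutionSet p S (a n) = {z}) ∧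
      (∀ n : ℕ, solutionSet p S (b n) = {z'}) ∧
      z ≠ z') ∧
    (¬ ∃ F : Y × U → Y × U, Continuous F ∧ ∀ d : Y × U, F d ∈ solutionSet p S d) ∧
    (¬ ∃ F : Y × U → U, Continuous F ∧ ∀ d : Y × U, (S (F d), F d) ∈ solutionSet p S d) := by
  let q : ENNReal := ENNReal.ofReal p
  have hqp : q.toReal = p := ENNReal.toReal_ofReal (by linarith)
  have : Fact (1 ≤ q) := ⟨ENNReal.one_le_ofReal.2 hp.le⟩
  obtain ⟨d, z, hz, z', hz', hne, hmin, hmin'⟩ :=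
    exists_two_nearest_lpGraph (q := q) (hqp.symm ▸ hp) hS hSw
  obtain ⟨a, had, ha⟩ := exists_tendsto_solutionSet_eq_singleton hp hqp hz hmin
  obtain ⟨b, hbd, hb⟩ := exists_tendsto_solutionSet_eq_singleton hp hqp hz' hmin'
  refine ⟨⟨WithLp.ofLp d, a, b, WithLp.ofLp z, WithLp.ofLp z', had, hbd, ha, hb,
    fun h => hne (WithLp.ofLp_injective q h)⟩, ?_, ?_⟩
  · rintro ⟨F, hF, hsol⟩
    have haF : ∀ n, F (a n) = WithLp.ofLp z := fun n => by simpa [ha] using hsol (a n)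
    have hbF : ∀ n, F (b n) = WithLp.ofLp z' := fun n => by simpa [hb] using hsol (b n)
    have h1 := (hF.tendsto _).comp had
    have h2 := (hF.tendsto _).comp hbd
    simp only [Function.comp_def, haF, hbF, tendsto_const_nhds_iff] at h1 h2
    exact hne (WithLp.ofLp_injective q (h1.trans h2.symm))
  · rintro ⟨F, hF, hsol⟩
    have haF : ∀ n, F (a n) = (WithLp.ofLp z).2 := fun n => by
      have h : (S (F (a n)), F (a n)) = WithLp.ofLp z :=
        Set.mem_singleton_iff.1 (ha n ▸ hsol (a n))
      rw [← h]
    have hbF : ∀ n, F (b n) = (WithLp.ofLp z').2 := fun n => by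
      have h : (S (F (b n)), F (b n)) = WithLp.ofLp z' :=
        Set.mem_singleton_iff.1 (hb n ▸ hsol (b n))
      rw [← h]
    have h1 := (hF.tendsto _).comp had
    have h2 := (hF.tendsto _).comp hbd
    simp only [Function.comp_def, haF, hbF, tendsto_const_nhds_iff] at h1 h2
    have hsnd : z.snd = z'.snd := h1.trans h2.symm
    have hfst : z.fst = z'.fst := hz.trans ((congrArg S hsnd).trans hz'.symm)
    exact hne (WithLp.ofLp_injective q (Prod.ext hfst hsnd))
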